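/- Let $\mathbb{K}=\mathbb{R}$ or $\mathbb{C}$, let $d\ge 1$, and let $\mathcal{A}=(A_1,\dots,A_d)$ be symmetric/Hermitian positive semidefinite matrices in $\mathbb{K}^{n\times n}$. Put $$\mathrm{Opt}(\mathcal{A})=\max_{x\in\mathbb{K}^n,\ \|x\|=1}\Big(\prod_{i=1}^d\langle x,A_ix\rangle\Big)^{1/d},\qquad \mathrm{OptSDP}(\mathcal{A})=\max_{X\succeq 0,\ \operatorname{Tr}X=1}\Big(\prod_{i=1}^d\langle A_i,X\rangle\Big)^{1/d},$$ where $X\in\mathbb{K}^{n\times n}$ is symmetric/Hermitian and $\langle A,X\rangle=\operatorname{Tr}(A^\dagger X)$. Suppose $X^*$ is an optimal solution of the second problem (the SDP relaxation), with $\operatorname{rank}(X^*)=r$. Let $\gamma$ be the Euler–Mascheroni constant, $\psi(x)=\frac{d}{dx}\log\Gamma(x)$, and $$L_r(\mathbb{R})=\gamma+\log 2+\psi\big(\tfrac r2\big)-\log\tfrac r2,\qquad L_r(\mathbb{C})=\gamma+\psi(r)-\log r .$$ Then both maxima are attained, $L_r(\mathbb{R})<1.271$, $L_r(\mathbb{C})<0.578$,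 and $$e^{-L_r(\mathbb{K})}\,\mathrm{OptSDP}(\mathcal{A})\le \mathrm{Opt}(\mathcal{A})\le \mathrm{OptSDP}(\mathcal{A}).$$ Moreover, let $x\sim\mathcal{N}_{\mathbb{K}}(0,X^*)$ be the centred Gaussian vector with covariance $X^*$ (circularly symmetric when $\mathbb{K}=\mathbb{C}$, normalized so that $\mathcal{N}_{\mathbb{C}}(0,I_n)$ has independent coordinates $(u+iv)/\sqrt2$ with $u,v$ independent standard real normals), and let $y=x/\|x\|$. Then almost surely $\|y\|=1$, the geometric mean of the $\langle y,A_iy\rangle$ is integrable, and $$\mathbb{E}_y\Big[\Big(\prod_{i=1}^d\langle y,A_iy\rangle\Big)^{1/d}\Big]\ \ge\ e^{-L_r(\mathbb{K})}\,\mathrm{OptSDP}(\mathcal{A}).$$ -/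

import Mathlib

open MeasureTheory ProbabilityTheory
open scoped ComplexOrder MatrixOrder Matrix

namespace ProductPSD

noncomputable section

variable {𝕜 : Type*} [RCLike 𝕜] {n d : ℕ}

/-- The quadratic form `⟨x, A x⟩`, which is a real number when `A` is symmetric/Hermitian. -/
def quadForm (A : Matrix (Fin n) (Fin n) 𝕜) (x : EuclideanSpace 𝕜 (Fin n)) : ℝ :=
  RCLike.re (inner 𝕜 x (Matrix.toEuclideanCLM (𝕜 := 𝕜) A x))

/-- The trace inner product `⟨A, X⟩ = Tr(A† X)`, a real number for Hermitian `A`, `X`. -/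
def traceInner (A X : Matrix (Fin n) (Fin n) 𝕜) : ℝ :=
  RCLike.re (Aᴴ * X).trace

/-- The geometric mean `(∏ i, ⟨x, A i x⟩) ^ (1 / d)`. -/
def objective (A : Fin d → Matrix (Fin n) (Fin n) 𝕜) (x : EuclideanSpace 𝕜 (Fin n)) : ℝ :=
  (∏ i, quadForm (A i) x) ^ (1 / (d : ℝ))

/-- The values attained by the objective on the unit sphere of `𝕜ⁿ`. -/
def sphereValues (A : Fin d → Matrix (Fin n) (Fin n) 𝕜) : Set ℝ :=
  {v | ∃ x : EuclideanSpace 𝕜 (Fin n), ‖x‖ = 1 ∧ objective A x = v}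

/-- `Opt(A)`, the optimum of the geometric mean over the unit sphere. -/
def Opt (A : Fin d → Matrix (Fin n) (Fin n) 𝕜) : ℝ := sSup (sphereValues A)

/-- Feasible points of the relaxation: positive semidefinite (in particular symmetric/Hermitian)
matrices of trace one. -/
def IsFeasible (X : Matrix (Fin n) (Fin n) 𝕜) : Prop :=
  X.PosSemidef ∧ X.trace = 1

/-- The objective `(∏ i, ⟨A i, X⟩) ^ (1 / d)` of the relaxation. -/
def sdpObjective (A : Fin d → Matrix (Fin n) (Fin n) 𝕜) (X : Matrix (Fin n) (Fin n) 𝕜) : ℝ :=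
  (∏ i, traceInner (A i) X) ^ (1 / (d : ℝ))

/-- The values attained by the objective of the relaxation on its feasible set. -/
def sdpValues (A : Fin d → Matrix (Fin n) (Fin n) 𝕜) : Set ℝ :=
  {v | ∃ X : Matrix (Fin n) (Fin n) 𝕜, IsFeasible X ∧ sdpObjective A X = v}

/-- `OptSDP(A)`, the optimum of the semidefinite relaxation. -/
def OptSDP (A : Fin d → Matrix (Fin n) (Fin n) 𝕜) : ℝ := sSup (sdpValues A)

/-- `X` is an optimal solution of the semidefinite relaxation. -/
def IsOptimalSDP (A : Fin d → Matrix (Fin n) (Fin n) 𝕜) (X : Matrix (Fin n) (Fin n) 𝕜) : Prop :=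
  IsFeasible X ∧ ∀ Y, IsFeasible Y → sdpObjective A Y ≤ sdpObjective A X

/-- The digamma function `ψ(x) = d/dx log Γ(x)` on the positive reals. -/
def digamma (x : ℝ) : ℝ := deriv (fun t : ℝ => Real.log (Real.Gamma t)) x

/-- `L_r(ℝ) = γ + log 2 + ψ(r/2) - log(r/2)`. -/
def LReal (r : ℕ) : ℝ :=
  Real.eulerMascheroniConstant + Real.log 2 + digamma ((r : ℝ) / 2) - Real.log ((r : ℝ) / 2)

/-- `L_r(ℂ) = γ + ψ(r) - log r`. -/
def LComplex (r : ℕ) : ℝ :=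
  Real.eulerMascheroniConstant + digamma (r : ℝ) - Real.log (r : ℝ)

/-- The standard complex normal law: the law of `(y + i z) / √2` with `y`, `z` independent
standard real normal variables. -/
def stdComplexNormal : Measure ℂ :=
  ((gaussianReal 0 1).prod (gaussianReal 0 1)).map
    (fun p : ℝ × ℝ => ((p.1 : ℂ) + Complex.I * (p.2 : ℂ)) / (Real.sqrt 2 : ℂ))

/-- The standard Gaussian law `N_ℂ(0, I_n)`: independent standard complex normal coordinates. -/
def stdComplexGaussian (n : ℕ) : Measure (EuclideanSpace ℂ (Fin n)) :=
  (Measure.pi (fun _ : Fin n => stdComplexNormal)).map (WithLp.toLp 2)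

/-- The circularly symmetric Gaussian law `N_ℂ(0, S)` for positive semidefinite `S`: the law of
`S^{1/2} z` with `z ∼ N_ℂ(0, I_n)`. -/
def complexGaussian (S : Matrix (Fin n) (Fin n) ℂ) : Measure (EuclideanSpace ℂ (Fin n)) :=
  (stdComplexGaussian n).map (fun z => Matrix.toEuclideanCLM (𝕜 := ℂ) (CFC.sqrt S) z)

/-- The law of the normalized vector `x / ‖x‖` when `x` has law `μ`. -/
def normalizedLaw (μ : Measure (EuclideanSpace 𝕜 (Fin n))) : Measure (EuclideanSpace 𝕜 (Fin n)) :=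
  μ.map (fun x => ((‖x‖⁻¹ : ℝ) : 𝕜) • x)

end

end ProductPSD

/-!
The idea is to compare expected logarithms. Let `g` be a standard Gaussian vector of `𝕜ⁿ`, seen as a
real Euclidean space, and `x = X^{1/2} g`; the vector `y = x / ‖x‖` has the law of the rounding
procedure, in the complex case as well, because normalization forgets the factor `1 / √2` that
separates `N_ℂ(0, I)` from the standard real Gaussian law. By Jensen's inequality for the
exponential,

`𝔼 (∏ ⟨y, A i y⟩)^{1/d} ≥ exp ((1/d) ∑ 𝔼 log ⟨x, A i x⟩ - 𝔼 log ‖x‖²)`,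

and `⟨x, A i x⟩` and `‖x‖²` are the quadratic forms of `X^{1/2} (A i) X^{1/2}` and of `X` at `g`,
with traces `⟨A i, X⟩` and `1`. Everything thus reduces to bounding `𝔼 log ⟨g, B g⟩` for a positive
semidefinite `B` of rank `r > 0`. In an eigenbasis, `⟨g, B g⟩ = ∑ ℓ j * w j`, where the `ℓ j` are the
`r` nonzero eigenvalues and the `w j` are the squared moduli of the coordinates of `g`.

* Concavity of `log` with weights `ℓ j / tr B` gives `𝔼 log ⟨g, B g⟩ ≥ log tr B + 𝔼 log w`, with `w`
  any one of the `w j` (`le_integral_log_sum_mul`).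
* The expectation is invariant under cyclic shifts of the `ℓ j`, by rotation invariance; averaging
  over the shifts and using concavity gives `𝔼 log ⟨g, B g⟩ ≤ log (tr B / r) + 𝔼 log (∑ w j)`
  (`integral_log_sum_mul_le`).

With `m` the real dimension of `𝕜`, the variables `w` and `∑ w j` are chi-squared with `m` and `m r`
degrees of freedom (`map_norm_sq_stdGaussian`), and the expected logarithm of a chi-squared variable
with `k` degrees of freedom is `ψ(k / 2) + log 2` (`integral_log_gammaMeasure`). The resulting
exponent `ψ(m r / 2) - log r - ψ(m / 2)` is `L_r(𝕜)`, by the values of `ψ` at `1 / 2` and `1`.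

The numerical bounds on `L_r` follow from `ψ(x) ≤ log x` and from `γ < 0.5776`.
-/

namespace ProductPSD

/-! ### The digamma function and the Euler–Mascheroni constant -/

lemma differentiableAt_Gamma_of_pos {x : ℝ} (hx : 0 < x) : DifferentiableAt ℝ Real.Gamma x :=
  Real.differentiableAt_Gamma fun m => by
    have : (0 : ℝ) ≤ m := m.cast_nonneg
    linarith

lemma digamma_eq {x : ℝ} (hx : 0 < x) : digamma x = deriv Real.Gamma x / Real.Gamma x :=
  deriv.log (differentiableAt_Gamma_of_pos hx) (Real.Gamma_pos_of_pos hx).ne'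

lemma digamma_one : digamma 1 = -Real.eulerMascheroniConstant := by
  rw [digamma_eq one_pos, Real.hasDerivAt_Gamma_one.deriv, Real.Gamma_one, div_one]

lemma digamma_one_half :
    digamma (1 / 2) = -Real.eulerMascheroniConstant - 2 * Real.log 2 := by
  rw [digamma_eq (by norm_num), Real.hasDerivAt_Gamma_one_half.deriv, Real.Gamma_one_half_eq,
    neg_mul, neg_div, mul_div_cancel_left₀ _ (by positivity)]
  ring

/-- The tangent of the convex function `log Γ` at `x` lies below its chord over `[x, x + 1]`,
whose slope is `log x`. -/
lemma digamma_le_log {x : ℝ} (hx : 0 < x) : digamma x ≤ Real.log x := by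
  have hd : DifferentiableAt ℝ (Real.log ∘ Real.Gamma) x :=
    (differentiableAt_Gamma_of_pos hx).log (Real.Gamma_pos_of_pos hx).ne'
  have h := Real.convexOn_log_Gamma.deriv_le_slope (Set.mem_Ioi.2 hx)
    (Set.mem_Ioi.2 (by linarith : 0 < x + 1)) (by linarith) hd
  rw [slope_def_field, Function.comp_apply, Function.comp_apply, Real.Gamma_add_one hx.ne',
    Real.log_mul hx.ne' (Real.Gamma_pos_of_pos hx).ne'] at h
  simpa [digamma, Function.comp_def] using h

/-- The sequence `H_n - log (n + 1/2)` decreases to `γ`, much faster than `H_n - log n` does. -/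
lemma eulerMascheroniConstant_le (N : ℕ) :
    Real.eulerMascheroniConstant ≤ (harmonic N : ℝ) - Real.log (N + 1 / 2) := by
  have hanti : Antitone fun n : ℕ => (harmonic n : ℝ) - Real.log (n + 1 / 2) := by
    refine antitone_nat_of_succ_le fun n => ?_
    have h0 : (0 : ℝ) < n + 1 / 2 := by positivity
    have h1 := Real.le_log_one_add_of_nonneg (x := 1 / ((n : ℝ) + 1 / 2)) (by positivity)
    have h2 : 2 * (1 / ((n : ℝ) + 1 / 2)) / (1 / ((n : ℝ) + 1 / 2) + 2) = ((n : ℝ) + 1)⁻¹ := by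
      field_simp
      ring
    have h3 : 1 + 1 / ((n : ℝ) + 1 / 2) = (n + 1 + 1 / 2) / (n + 1 / 2) := by
      field_simp
      ring
    rw [h2, h3, Real.log_div (by positivity) h0.ne'] at h1
    rw [harmonic_succ]
    push_cast
    linarith
  refine le_of_tendsto Real.tendsto_harmonic_sub_log_add_one ?_
  filter_upwards [Filter.eventually_ge_atTop N] with n hn
  refine le_trans ?_ (hanti hn)
  have : Real.log (n + 1 / 2) ≤ Real.log (n + 1) :=
    Real.log_le_log (by positivity) (by linarith)
  linarith

lemma eulerMascheroniConstant_lt : Real.eulerMascheroniConstant < 0.5776 := by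
  -- `N = 16` suffices, and `16 + 1 / 2 = 2 ^ 4 * (1 + 1 / 32)` reduces its logarithm to `log 2`.
  have h := eulerMascheroniConstant_le 16
  have h1 := Real.le_log_one_add_of_nonneg (x := 1 / 32) (by norm_num)
  have h2 : Real.log (((16 : ℕ) : ℝ) + 1 / 2) = 4 * Real.log 2 + Real.log (1 + 1 / 32) := by
    rw [show (((16 : ℕ) : ℝ) + 1 / 2) = 2 ^ 4 * (1 + 1 / 32) by norm_num,
      Real.log_mul (by norm_num) (by norm_num), Real.log_pow]
    norm_num
  have h3 : harmonic 16 = 2436559 / 720720 := by norm_num [harmonic, Finset.sum_range_succ]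
  rw [h2, h3] at h
  have := Real.log_two_gt_d9
  norm_num at h h1 ⊢
  linarith

lemma LReal_lt {r : ℕ} (hr : 0 < r) : LReal r < 1.271 := by
  have h := digamma_le_log (x := (r : ℝ) / 2) (by positivity)
  have := eulerMascheroniConstant_lt
  have := Real.log_two_lt_d9
  unfold LReal
  norm_num at *
  linarith

lemma LComplex_lt {r : ℕ} (hr : 0 < r) : LComplex r < 0.578 := by
  have h := digamma_le_log (x := (r : ℝ)) (by positivity)
  have := eulerMascheroniConstant_lt
  unfold LComplex
  norm_num at *
  linarith

/-! ### The expected logarithm of a Gamma variable -/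

/-- Differentiating the Mellin transform `Γ(s) = ∫ t ^ (s - 1) e^{-t}` under the integral sign. -/
lemma integrableOn_log_mul_rpow_mul_exp {a : ℝ} (ha : 0 < a) :
    IntegrableOn (fun t : ℝ => t ^ (a - 1) * (Real.log t * Real.exp (-t))) (Set.Ioi 0) ∧
      ∫ t in Set.Ioi (0 : ℝ), t ^ (a - 1) * (Real.log t * Real.exp (-t)) =
        deriv Real.Gamma a := by
  have hexp : Continuous fun t : ℝ => Complex.ofReal (Real.exp (-t)) := by fun_prop
  have hint : MellinConvergent (fun t : ℝ => Real.log t • Complex.ofReal (Real.exp (-t))) a := by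
    refine (mellin_hasDerivAt_of_isBigO_rpow (a := a + 1) (b := 0)
      (hexp.continuousOn.locallyIntegrableOn measurableSet_Ioi) ?_ (by simp) ?_ (by simpa)).1
    · rw [← Asymptotics.isBigO_norm_left]
      simp_rw [Complex.norm_real, Asymptotics.isBigO_norm_left]
      simpa only [neg_one_mul] using (isLittleO_exp_neg_mul_rpow_atTop zero_lt_one _).isBigO
    · simp_rw [neg_zero, Real.rpow_zero]
      exact (hexp.tendsto 0).mono_left nhdsWithin_le_nhds |>.isBigO_one ℝ
  have hpt : ∀ t ∈ Set.Ioi (0 : ℝ), (t : ℂ) ^ ((a : ℂ) - 1) * (Real.log t * Real.exp (-t)) =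
      ((t ^ (a - 1) * (Real.log t * Real.exp (-t)) : ℝ) : ℂ) := fun t ht => by
    rw [← Complex.ofReal_one, ← Complex.ofReal_sub, ← Complex.ofReal_cpow (le_of_lt ht)]
    push_cast
    rfl
  have hderiv := (Complex.hasDerivAt_GammaIntegral (s := a) (by simpa)).congr_of_eventuallyEq
    (f₁ := Complex.Gamma) (by
      filter_upwards [(isOpen_lt continuous_const Complex.continuous_re).mem_nhds
        (show (0 : ℝ) < (a : ℂ).re by simpa)] with s hs using Complex.Gamma_eq_integral hs)
  rw [setIntegral_congr_fun measurableSet_Ioi hpt, integral_complex_ofReal] at hderiv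
  constructor
  · have := (hint.congr_fun (g := fun t : ℝ =>
      ((t ^ (a - 1) * (Real.log t * Real.exp (-t)) : ℝ) : ℂ)) (fun t ht => by
        simpa using hpt t ht) measurableSet_Ioi).re
    simpa only [IntegrableOn, RCLike.re_eq_complex_re, Complex.ofReal_re] using this
  · have := hderiv.real_of_complex
    simp only [Complex.Gamma_ofReal, Complex.ofReal_re] at this
    exact this.deriv.symm

/-- The law of a Gamma variable of shape `a` and rate `1 / 2` (a chi-squared variable with `2 a`
degrees of freedom) has expected logarithm `ψ(a) + log 2`. -/
lemma integral_log_gammaMeasure {a : ℝ} (ha : 0 < a) :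
    Integrable Real.log (gammaMeasure a (1 / 2)) ∧
      ∫ t, Real.log t ∂gammaMeasure a (1 / 2) = digamma a + Real.log 2 := by
  have hΓ := Real.Gamma_pos_of_pos ha
  obtain ⟨hint, hval⟩ := integrableOn_log_mul_rpow_mul_exp ha
  have hint' := Real.GammaIntegral_convergent ha
  -- The substitution `t ↦ 2 t` turns rate `1 / 2` into rate `1`.
  have hdens : ∀ t ∈ Set.Ioi (0 : ℝ), gammaPDFReal a (1 / 2) (2 * t) * Real.log (2 * t) =
      (2 * Real.Gamma a)⁻¹ * (t ^ (a - 1) * (Real.log t * Real.exp (-t)) +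
        Real.log 2 * (Real.exp (-t) * t ^ (a - 1))) := fun t ht => by
    have ht : 0 < t := ht
    have h2 : ((1 : ℝ) / 2) ^ a * 2 ^ (a - 1) = 2⁻¹ := by
      rw [Real.rpow_sub_one two_ne_zero, mul_div_assoc', ← Real.mul_rpow (by norm_num) (by norm_num)]
      norm_num
    rw [gammaPDFReal, if_pos (by positivity), Real.log_mul two_ne_zero ht.ne',
      Real.mul_rpow zero_le_two ht.le, show 1 / 2 * (2 * t) = t by ring, mul_inv, ← h2]
    field_simp
    ring
  have hsum := (hint.add (hint'.const_mul (Real.log 2))).const_mul (2 * Real.Gamma a)⁻¹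
  have hIoi : IntegrableOn (fun t => gammaPDFReal a (1 / 2) t * Real.log t) (Set.Ioi 0) := by
    have := (integrableOn_Ioi_comp_mul_left_iff
      (fun t => gammaPDFReal a (1 / 2) t * Real.log t) 0 two_pos).1
      (IntegrableOn.congr_fun hsum (fun t ht => (hdens t ht).symm) measurableSet_Ioi)
    simpa using this
  have hIic : ∀ t ∉ Set.Ioi (0 : ℝ), gammaPDFReal a (1 / 2) t * Real.log t = 0 := fun t ht => by
    rcases (Set.notMem_Ioi.1 ht).lt_or_eq with h | rfl
    · simp [gammaPDFReal, not_le.2 h]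
    · simp
  have hreal : ∀ t, (gammaPDF a (1 / 2) t).toReal = gammaPDFReal a (1 / 2) t := fun t =>
    ENNReal.toReal_ofReal (gammaPDFReal_nonneg ha (by norm_num) t)
  have hmeas : Measurable (gammaPDF a (1 / 2)) :=
    (measurable_gammaPDFReal a (1 / 2)).ennreal_ofReal
  have hfin : ∀ᵐ t, gammaPDF a (1 / 2) t < ⊤ := by
    filter_upwards with t using ENNReal.ofReal_lt_top
  constructor
  · rw [gammaMeasure, integrable_withDensity_iff_integrable_smul' hmeas hfin]
    simp_rw [hreal, smul_eq_mul]
    exact (integrableOn_iff_integrable_of_support_subset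
      (Function.support_subset_iff'.2 hIic)).1 hIoi
  · rw [gammaMeasure, integral_withDensity_eq_integral_toReal_smul hmeas hfin]
    simp_rw [hreal, smul_eq_mul]
    rw [← setIntegral_eq_integral_of_forall_compl_eq_zero hIic]
    have hsub := integral_comp_mul_left_Ioi
      (fun t => gammaPDFReal a (1 / 2) t * Real.log t) 0 (two_pos (α := ℝ))
    rw [mul_zero, smul_eq_mul, setIntegral_congr_fun measurableSet_Ioi hdens, integral_const_mul,
      integral_add hint (hint'.const_mul _), integral_const_mul, hval,
      ← Real.Gamma_eq_integral ha] at hsub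
    rw [digamma_eq ha]
    field_simp at hsub ⊢
    linarith

/-! ### The squared norm of a Gaussian vector -/

/-- Also true for `1 / 2 ≤ t`: the integrand is then not integrable, and both sides are `0`. -/
lemma integral_exp_mul_sq_gaussianReal (t : ℝ) :
    ∫ x, Real.exp (t * x ^ 2) ∂gaussianReal 0 1 =
      (√(2 * Real.pi))⁻¹ * √(Real.pi / (1 / 2 - t)) := by
  rw [integral_gaussianReal_eq_integral_smul one_ne_zero, ← integral_gaussian,
    ← integral_const_mul]
  refine integral_congr_ae (.of_forall fun x => ?_)
  simp only [gaussianPDFReal, NNReal.coe_one, mul_one, sub_zero, smul_eq_mul]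
  rw [mul_assoc, ← Real.exp_add]
  ring_nf

section StdGaussian

variable {F : Type*} [NormedAddCommGroup F] [InnerProductSpace ℝ F] [FiniteDimensional ℝ F]
  [MeasurableSpace F] [BorelSpace F]

lemma mgf_norm_sq_stdGaussian (t : ℝ) :
    mgf (fun x => ‖x‖ ^ 2) (stdGaussian F) t =
      ((√(2 * Real.pi))⁻¹ * √(Real.pi / (1 / 2 - t))) ^ Module.finrank ℝ F := by
  have hnorm : ∀ x : Fin (Module.finrank ℝ F) → ℝ,
      ‖∑ i, x i • stdOrthonormalBasis ℝ F i‖ ^ 2 = ∑ i, x i ^ 2 := fun x => by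
    rw [← real_inner_self_eq_norm_sq, (stdOrthonormalBasis ℝ F).orthonormal.inner_sum]
    simp [pow_two]
  rw [mgf, stdGaussian, integral_map (Measurable.aemeasurable (by fun_prop))
    (Measurable.aestronglyMeasurable (by fun_prop))]
  simp_rw [hnorm, Finset.mul_sum, Real.exp_sum]
  rw [integral_fintype_prod_eq_prod (f := fun _ x => Real.exp (t * x ^ 2))]
  simp [integral_exp_mul_sq_gaussianReal]

/-- For `1 / 2 ≤ t` the exponential is not integrable and the moment generating function takes its
default value `0`. -/
lemma mgf_gammaMeasure {a : ℝ} (ha : 0 < a) (t : ℝ) :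
    mgf id (gammaMeasure a (1 / 2)) t = if t < 1 / 2 then (1 - 2 * t)⁻¹ ^ a else 0 := by
  have hΓ := Real.Gamma_pos_of_pos ha
  have hreal : ∀ x, (gammaPDF a (1 / 2) x).toReal = gammaPDFReal a (1 / 2) x := fun x =>
    ENNReal.toReal_ofReal (gammaPDFReal_nonneg ha (by norm_num) x)
  have hmeas : Measurable (gammaPDF a (1 / 2)) :=
    (measurable_gammaPDFReal a (1 / 2)).ennreal_ofReal
  have hfin : ∀ᵐ x, gammaPDF a (1 / 2) x < ⊤ := by
    filter_upwards with x using ENNReal.ofReal_lt_top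
  have hdens : ∀ x ∈ Set.Ici (0 : ℝ), gammaPDFReal a (1 / 2) x * Real.exp (t * x) =
      ((1 / 2) ^ a / Real.Gamma a) * (x ^ (a - 1) * Real.exp (-((1 / 2 - t) * x))) := fun x hx => by
    rw [gammaPDFReal, if_pos (show 0 ≤ x from hx), mul_assoc, mul_assoc, ← Real.exp_add]
    ring_nf
  have hneg : ∀ x ∉ Set.Ici (0 : ℝ), gammaPDFReal a (1 / 2) x * Real.exp (t * x) = 0 :=
    fun x hx => by simp [gammaPDFReal, show ¬ 0 ≤ x from hx]
  split_ifs with ht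
  · rw [mgf, gammaMeasure, integral_withDensity_eq_integral_toReal_smul hmeas hfin]
    simp_rw [hreal, smul_eq_mul, id]
    rw [← setIntegral_eq_integral_of_forall_compl_eq_zero hneg,
      setIntegral_congr_fun measurableSet_Ici hdens, integral_Ici_eq_integral_Ioi,
      integral_const_mul, Real.integral_rpow_mul_exp_neg_mul_Ioi ha (by linarith)]
    have h1 : (1 : ℝ) / 2 * (1 / (1 / 2 - t)) = (1 - 2 * t)⁻¹ := by
      rw [show 1 - 2 * t = 2 * (1 / 2 - t) by ring, mul_inv]
      ring
    rw [← h1, Real.mul_rpow (by norm_num) (by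
      have : 0 < 1 / 2 - t := by linarith
      positivity)]
    field_simp
  · refine mgf_undef fun h => ?_
    rw [gammaMeasure, integrable_withDensity_iff_integrable_smul' hmeas hfin] at h
    simp_rw [hreal, smul_eq_mul, id] at h
    have h1 := (IntegrableOn.congr_fun (h.integrableOn (s := Set.Ici 0)) hdens
      measurableSet_Ici).mono_set Set.Ioi_subset_Ici_self
    -- For `1 / 2 ≤ t` the integrand dominates a power of `x`.
    refine not_integrableOn_Ioi_rpow (a - 1) ?_
    refine ((h1.const_mul ((1 / 2) ^ a / Real.Gamma a)⁻¹).mono'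
      (by fun_prop : Measurable fun x : ℝ => x ^ (a - 1)).aestronglyMeasurable ?_)
    filter_upwards [ae_restrict_mem measurableSet_Ioi] with x hx
    have hx : 0 < x := hx
    rw [← mul_assoc, inv_mul_cancel₀ (by positivity), one_mul, Real.norm_of_nonneg (by positivity)]
    refine le_mul_of_one_le_right (by positivity) (Real.one_le_exp ?_)
    nlinarith

/-- `‖x‖²` is a chi-squared variable, i.e. Gamma distributed: the two moment generating functions
agree, and they are finite near `0`. -/
lemma map_norm_sq_stdGaussian (hF : 0 < Module.finrank ℝ F) :
    (stdGaussian F).map (fun x => ‖x‖ ^ 2) =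
      gammaMeasure ((Module.finrank ℝ F : ℝ) / 2) (1 / 2) := by
  have ha : 0 < (Module.finrank ℝ F : ℝ) / 2 := by positivity
  have := isProbabilityMeasure_gammaMeasure ha (r := 1 / 2) (by norm_num)
  have hmgf : mgf id (gammaMeasure ((Module.finrank ℝ F : ℝ) / 2) (1 / 2)) =
      mgf (fun x => ‖x‖ ^ 2) (stdGaussian F) := by
    ext t
    rw [mgf_norm_sq_stdGaussian, mgf_gammaMeasure ha]
    split_ifs with ht
    · have h0 : 0 < 1 / 2 - t := by linarith
      have h1 : (√(2 * Real.pi))⁻¹ * √(Real.pi / (1 / 2 - t)) = (1 - 2 * t)⁻¹ ^ (1 / 2 : ℝ) := by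
        rw [← Real.sqrt_inv, ← Real.sqrt_mul (by positivity), ← Real.sqrt_eq_rpow,
          show 1 - 2 * t = 2 * (1 / 2 - t) by ring]
        congr 1
        field_simp
      rw [h1, ← Real.rpow_natCast, ← Real.rpow_mul (by
        rw [inv_nonneg]
        linarith)]
      congr 1
      ring
    · rw [Real.sqrt_eq_zero'.2 (div_nonpos_of_nonneg_of_nonpos Real.pi_pos.le (by linarith)),
        mul_zero, zero_pow hF.ne']
  have h0 : (0 : ℝ) ∈ interior
      (integrableExpSet id (gammaMeasure ((Module.finrank ℝ F : ℝ) / 2) (1 / 2))) := by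
    refine mem_interior_iff_mem_nhds.2 ?_
    filter_upwards [Iio_mem_nhds (show (0 : ℝ) < 1 / 2 by norm_num)] with t ht
    by_contra hcon
    have h2 := mgf_gammaMeasure ha t
    rw [mgf_undef hcon, if_pos (show t < 1 / 2 from ht)] at h2
    have h3 : 0 < (1 - 2 * t)⁻¹ := inv_pos.2 (by
      have : t < 1 / 2 := ht
      linarith)
    exact absurd h2 (by positivity)
  have hX : AEMeasurable (fun x : F => ‖x‖ ^ 2) (stdGaussian F) := by fun_prop
  have := Measure.isProbabilityMeasure_map hX
  refine Measure.ext_of_charFun (funext fun t => ?_)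
  rw [← complexMGF_mul_I hX, ← complexMGF_id_mul_I]
  exact (eqOn_complexMGF_of_mgf hmgf (by simpa using h0)).symm

lemma integrable_log_norm_sq_stdGaussian (hF : 0 < Module.finrank ℝ F) :
    Integrable (fun x => Real.log (‖x‖ ^ 2)) (stdGaussian F) := by
  have h := (integral_log_gammaMeasure (a := (Module.finrank ℝ F : ℝ) / 2) (by positivity)).1
  rw [← map_norm_sq_stdGaussian hF] at h
  exact h.comp_measurable (by fun_prop)

lemma integral_log_norm_sq_stdGaussian (hF : 0 < Module.finrank ℝ F) :
    ∫ x, Real.log (‖x‖ ^ 2) ∂stdGaussian F =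
      digamma ((Module.finrank ℝ F : ℝ) / 2) + Real.log 2 := by
  rw [← (integral_log_gammaMeasure (a := (Module.finrank ℝ F : ℝ) / 2) (by positivity)).2,
    ← map_norm_sq_stdGaussian hF, integral_map (by fun_prop)
      Real.measurable_log.aestronglyMeasurable]

lemma ae_ne_zero_stdGaussian (hF : 0 < Module.finrank ℝ F) : ∀ᵐ x ∂stdGaussian F, x ≠ 0 := by
  have h : ∀ᵐ t ∂(stdGaussian F).map (fun x => ‖x‖ ^ 2), t ≠ 0 := by
    rw [map_norm_sq_stdGaussian hF]
    exact (withDensity_absolutelyContinuous _ _).ae_le (Measure.ae_ne volume 0)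
  filter_upwards [ae_of_ae_map (by fun_prop) h] with x hx
  simpa using hx

end StdGaussian

/-! ### Coordinates of a Gaussian vector along an orthonormal family -/

section Coordinates

variable {𝕜 E κ : Type*} [RCLike 𝕜] [Fintype κ] [NormedAddCommGroup E] [InnerProductSpace 𝕜 E]
  [InnerProductSpace ℝ E] [FiniteDimensional ℝ E] [MeasurableSpace E] [BorelSpace E]

/-- The coordinates of a standard Gaussian vector along a `𝕜`-orthonormal family form a standard
Gaussian vector of `𝕜^κ`. The real structure of `E` may be any one that is compatible with its
`𝕜`-structure. -/
lemma map_inner_stdGaussian (hE : ∀ x y : E, inner ℝ x y = RCLike.re (inner 𝕜 x y))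
    {v : κ → E} (hv : Orthonormal 𝕜 v) :
    (stdGaussian E).map (fun g => WithLp.toLp 2 fun j => inner 𝕜 (v j) g) =
      stdGaussian (EuclideanSpace 𝕜 κ) := by
  have hmeas : Measurable fun g : E => (WithLp.toLp 2 fun j => inner 𝕜 (v j) g :
      EuclideanSpace 𝕜 κ) := by fun_prop
  have := Measure.isProbabilityMeasure_map hmeas.aemeasurable (μ := stdGaussian E)
  refine Measure.ext_of_charFun (funext fun t => ?_)
  have hin : ∀ g : E, inner ℝ (WithLp.toLp 2 fun j => inner 𝕜 (v j) g : EuclideanSpace 𝕜 κ) t =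
      inner ℝ g (∑ j, t j • v j) := fun g => by
    rw [hE, inner_sum, map_sum, PiLp.inner_apply]
    refine Finset.sum_congr rfl fun j _ => ?_
    rw [inner_smul_right, ← inner_conj_symm g (v j)]
    simp [real_inner_eq_re_inner 𝕜, RCLike.inner_apply]
  have hnorm : ‖∑ j, t j • v j‖ ^ 2 = ‖t‖ ^ 2 := by
    rw [← inner_self_eq_norm_sq (𝕜 := 𝕜), hv.inner_sum, EuclideanSpace.norm_sq_eq, map_sum]
    refine Finset.sum_congr rfl fun j _ => ?_
    rw [RCLike.conj_mul]
    norm_cast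
  rw [charFun_apply, integral_map hmeas.aemeasurable (by fun_prop)]
  simp_rw [hin]
  rw [← charFun_apply, charFun_stdGaussian, charFun_stdGaussian, ← Complex.ofReal_pow, hnorm,
    Complex.ofReal_pow]

end Coordinates

/-! ### Expected logarithms of Gaussian quadratic forms -/

section ExpectedLog

variable {𝕜 E κ : Type*} [RCLike 𝕜] [Fintype κ] [NormedAddCommGroup E] [InnerProductSpace 𝕜 E]
  [InnerProductSpace ℝ E] [FiniteDimensional ℝ E] [MeasurableSpace E] [BorelSpace E]

lemma finrank_real_euclideanSpace :
    Module.finrank ℝ (EuclideanSpace 𝕜 κ) = Module.finrank ℝ 𝕜 * Fintype.card κ := by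
  rw [← Module.finrank_mul_finrank ℝ 𝕜, finrank_euclideanSpace]

lemma log_sum_norm_inner_sq (hE : ∀ x y : E, inner ℝ x y = RCLike.re (inner 𝕜 x y)) [Nonempty κ]
    {v : κ → E} (hv : Orthonormal 𝕜 v) :
    Integrable (fun g => Real.log (∑ j, ‖inner 𝕜 (v j) g‖ ^ 2)) (stdGaussian E) ∧
      ∫ g, Real.log (∑ j, ‖inner 𝕜 (v j) g‖ ^ 2) ∂stdGaussian E =
        digamma (((Module.finrank ℝ 𝕜 * Fintype.card κ : ℕ) : ℝ) / 2) + Real.log 2 := by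
  have hpos : 0 < Module.finrank ℝ (EuclideanSpace 𝕜 κ) := by
    rw [finrank_real_euclideanSpace]
    exact Nat.mul_pos Module.finrank_pos Fintype.card_pos
  have hmeas : Measurable fun g : E => (WithLp.toLp 2 fun j => inner 𝕜 (v j) g :
      EuclideanSpace 𝕜 κ) := by fun_prop
  have hnorm : (fun g : E => Real.log (∑ j, ‖inner 𝕜 (v j) g‖ ^ 2)) =
      (fun z : EuclideanSpace 𝕜 κ => Real.log (‖z‖ ^ 2)) ∘
        fun g => WithLp.toLp 2 fun j => inner 𝕜 (v j) g := by
    ext g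
    simp [EuclideanSpace.norm_sq_eq]
  have h1 := integrable_log_norm_sq_stdGaussian hpos
  have h2 := integral_log_norm_sq_stdGaussian hpos
  rw [← map_inner_stdGaussian hE hv] at h1 h2
  rw [integral_map hmeas.aemeasurable (Measurable.aestronglyMeasurable (by fun_prop))] at h2
  rw [finrank_real_euclideanSpace] at h2
  rw [hnorm]
  exact ⟨h1.comp_measurable hmeas, h2⟩

lemma log_norm_inner_sq (hE : ∀ x y : E, inner ℝ x y = RCLike.re (inner 𝕜 x y)) {u : E}
    (hu : ‖u‖ = 1) :
    Integrable (fun g => Real.log (‖inner 𝕜 u g‖ ^ 2)) (stdGaussian E) ∧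
      ∫ g, Real.log (‖inner 𝕜 u g‖ ^ 2) ∂stdGaussian E =
        digamma ((Module.finrank ℝ 𝕜 : ℝ) / 2) + Real.log 2 := by
  have hv : Orthonormal 𝕜 fun _ : Unit => u := by
    rw [orthonormal_iff_ite]
    simp [inner_self_eq_norm_sq_to_K, hu]
  simpa using log_sum_norm_inner_sq hE hv

lemma ae_inner_ne_zero (hE : ∀ x y : E, inner ℝ x y = RCLike.re (inner 𝕜 x y)) {u : E}
    (hu : ‖u‖ = 1) : ∀ᵐ g ∂stdGaussian E, inner 𝕜 u g ≠ 0 := by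
  have hv : Orthonormal 𝕜 fun _ : Unit => u := by
    rw [orthonormal_iff_ite]
    simp [inner_self_eq_norm_sq_to_K, hu]
  have h := ae_ne_zero_stdGaussian (F := EuclideanSpace 𝕜 Unit) (by
    rw [finrank_real_euclideanSpace]
    exact Nat.mul_pos Module.finrank_pos Fintype.card_pos)
  rw [← map_inner_stdGaussian hE hv] at h
  filter_upwards [ae_of_ae_map (by fun_prop) h] with g hg h0
  exact hg (by ext; simp [h0])

/-- Jensen's inequality for the logarithm with weights `ℓ j / ∑ ℓ`. -/
lemma sum_mul_log_add_log_le {ℓ w : κ → ℝ} [Nonempty κ] (hℓ : ∀ j, 0 < ℓ j) (hw : ∀ j, 0 < w j) :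
    ∑ j, ℓ j / (∑ i, ℓ i) * Real.log (w j) + Real.log (∑ i, ℓ i) ≤
      Real.log (∑ j, ℓ j * w j) := by
  have hT : 0 < ∑ i, ℓ i := Finset.sum_pos (fun i _ => hℓ i) Finset.univ_nonempty
  have hS : 0 < ∑ i, ℓ i * w i :=
    Finset.sum_pos (fun i _ => mul_pos (hℓ i) (hw i)) Finset.univ_nonempty
  have h := strictConcaveOn_log_Ioi.concaveOn.le_map_sum (t := Finset.univ)
    (w := fun j => ℓ j / ∑ i, ℓ i) (p := w) (fun j _ => (div_pos (hℓ j) hT).le)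
    (by rw [← Finset.sum_div, div_self hT.ne']) fun j _ => hw j
  have h2 : ∑ j, (ℓ j / ∑ i, ℓ i) • w j = (∑ j, ℓ j * w j) / ∑ i, ℓ i := by
    rw [Finset.sum_div]
    exact Finset.sum_congr rfl fun j _ => by rw [smul_eq_mul, div_mul_eq_mul_div]
  rw [h2, Real.log_div hS.ne' hT.ne'] at h
  simp only [smul_eq_mul] at h
  linarith

lemma log_sum_mul_le {ℓ w : κ → ℝ} [Nonempty κ] (hℓ : ∀ j, 0 < ℓ j) (hw : ∀ j, 0 < w j) :
    Real.log (∑ j, ℓ j * w j) ≤ Real.log (∑ i, ℓ i) + Real.log (∑ i, w i) := by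
  have hT : 0 < ∑ i, ℓ i := Finset.sum_pos (fun i _ => hℓ i) Finset.univ_nonempty
  have hW : 0 < ∑ i, w i := Finset.sum_pos (fun i _ => hw i) Finset.univ_nonempty
  have hS : 0 < ∑ i, ℓ i * w i :=
    Finset.sum_pos (fun i _ => mul_pos (hℓ i) (hw i)) Finset.univ_nonempty
  rw [← Real.log_mul hT.ne' hW.ne', Finset.mul_sum]
  refine Real.log_le_log hS (Finset.sum_le_sum fun j _ => ?_)
  exact mul_le_mul_of_nonneg_right
    (Finset.single_le_sum (fun i _ => (hℓ i).le) (Finset.mem_univ j)) (hw j).le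

lemma ae_norm_inner_sq_pos (hE : ∀ x y : E, inner ℝ x y = RCLike.re (inner 𝕜 x y))
    {v : κ → E} (hv : Orthonormal 𝕜 v) :
    ∀ᵐ g ∂stdGaussian E, ∀ j, 0 < ‖inner 𝕜 (v j) g‖ ^ 2 := by
  rw [ae_all_iff]
  intro j
  filter_upwards [ae_inner_ne_zero hE (hv.1 j)] with g hg
  have := norm_pos_iff.2 hg
  positivity

lemma integrable_log_sum_mul (hE : ∀ x y : E, inner ℝ x y = RCLike.re (inner 𝕜 x y)) [Nonempty κ]
    {v : κ → E} (hv : Orthonormal 𝕜 v) {ℓ : κ → ℝ} (hℓ : ∀ j, 0 < ℓ j) :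
    Integrable (fun g => Real.log (∑ j, ℓ j * ‖inner 𝕜 (v j) g‖ ^ 2)) (stdGaussian E) := by
  have hlow : Integrable (fun g => ∑ j, ℓ j / (∑ i, ℓ i) * Real.log (‖inner 𝕜 (v j) g‖ ^ 2) +
      Real.log (∑ i, ℓ i)) (stdGaussian E) :=
    (integrable_finsetSum _ fun j _ => (log_norm_inner_sq hE (hv.1 j)).1.const_mul _).add
      (integrable_const _)
  have hup : Integrable (fun g => Real.log (∑ i, ℓ i) +
      Real.log (∑ j, ‖inner 𝕜 (v j) g‖ ^ 2)) (stdGaussian E) :=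
    (integrable_const _).add (log_sum_norm_inner_sq hE hv).1
  refine integrable_of_le_of_le (Measurable.aestronglyMeasurable (by fun_prop)) ?_ ?_ hlow hup
  · filter_upwards [ae_norm_inner_sq_pos hE hv] with g hg using sum_mul_log_add_log_le hℓ hg
  · filter_upwards [ae_norm_inner_sq_pos hE hv] with g hg using log_sum_mul_le hℓ hg

/-- Lower bound, by concavity of the logarithm: concentrating the whole weight on one
coordinate minimizes the expected logarithm. -/
lemma le_integral_log_sum_mul (hE : ∀ x y : E, inner ℝ x y = RCLike.re (inner 𝕜 x y))
    [Nonempty κ] {v : κ → E} (hv : Orthonormal 𝕜 v) {ℓ : κ → ℝ} (hℓ : ∀ j, 0 < ℓ j) :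
    digamma ((Module.finrank ℝ 𝕜 : ℝ) / 2) + Real.log 2 + Real.log (∑ i, ℓ i) ≤
      ∫ g, Real.log (∑ j, ℓ j * ‖inner 𝕜 (v j) g‖ ^ 2) ∂stdGaussian E := by
  have hT : 0 < ∑ i, ℓ i := Finset.sum_pos (fun i _ => hℓ i) Finset.univ_nonempty
  have hi : ∀ j ∈ Finset.univ, Integrable (fun g =>
      ℓ j / (∑ i, ℓ i) * Real.log (‖inner 𝕜 (v j) g‖ ^ 2)) (stdGaussian E) :=
    fun j _ => (log_norm_inner_sq hE (hv.1 j)).1.const_mul _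
  have h : ∫ g, (∑ j, ℓ j / (∑ i, ℓ i) * Real.log (‖inner 𝕜 (v j) g‖ ^ 2) +
      Real.log (∑ i, ℓ i)) ∂stdGaussian E ≤
        ∫ g, Real.log (∑ j, ℓ j * ‖inner 𝕜 (v j) g‖ ^ 2) ∂stdGaussian E := by
    refine integral_mono_ae ((integrable_finsetSum _ hi).add (integrable_const _))
      (integrable_log_sum_mul hE hv hℓ) ?_
    filter_upwards [ae_norm_inner_sq_pos hE hv] with g hg using sum_mul_log_add_log_le hℓ hg
  rw [integral_add (integrable_finsetSum _ hi) (integrable_const _), integral_finsetSum _ hi] at h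
  simp_rw [integral_const_mul, (log_norm_inner_sq hE (hv.1 _)).2] at h
  rw [← Finset.sum_mul, ← Finset.sum_div, div_self hT.ne'] at h
  simpa using h

/-- Upper bound: by rotation invariance, cyclically shifting the weights does not change the
expected logarithm, and the average over all shifts is handled by concavity, so that equal weights
maximize it. -/
lemma integral_log_sum_mul_le (hE : ∀ x y : E, inner ℝ x y = RCLike.re (inner 𝕜 x y)) {r : ℕ}
    [NeZero r] {v : Fin r → E} (hv : Orthonormal 𝕜 v) {ℓ : Fin r → ℝ} (hℓ : ∀ j, 0 < ℓ j) :
    ∫ g, Real.log (∑ j, ℓ j * ‖inner 𝕜 (v j) g‖ ^ 2) ∂stdGaussian E ≤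
      digamma (((Module.finrank ℝ 𝕜 * r : ℕ) : ℝ) / 2) + Real.log 2 + Real.log (∑ i, ℓ i) -
        Real.log r := by
  have hr : (0 : ℝ) < r := Nat.cast_pos.2 (NeZero.pos r)
  have hT : 0 < ∑ i, ℓ i := Finset.sum_pos (fun i _ => hℓ i) Finset.univ_nonempty
  have hshift : ∀ k : Fin r, Orthonormal 𝕜 fun j => v (j + k) :=
    fun k => hv.comp _ (add_left_injective k)
  have hinv : ∀ {u : Fin r → E}, Orthonormal 𝕜 u →
      ∫ g, Real.log (∑ j, ℓ j * ‖inner 𝕜 (u j) g‖ ^ 2) ∂stdGaussian E =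
        ∫ z, Real.log (∑ j, ℓ j * ‖z j‖ ^ 2) ∂stdGaussian (EuclideanSpace 𝕜 (Fin r)) :=
    fun {u} hu => by
      rw [← map_inner_stdGaussian hE hu, integral_map (by fun_prop)
        (Measurable.aestronglyMeasurable (by fun_prop))]
  have hi : ∀ k ∈ Finset.univ, Integrable (fun g =>
      (r : ℝ)⁻¹ * Real.log (∑ j, ℓ j * ‖inner 𝕜 (v (j + k)) g‖ ^ 2)) (stdGaussian E) :=
    fun k _ => (integrable_log_sum_mul hE (hshift k) hℓ).const_mul _
  have havg : ∫ g, Real.log (∑ j, ℓ j * ‖inner 𝕜 (v j) g‖ ^ 2) ∂stdGaussian E =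
      ∫ g, ∑ k, (r : ℝ)⁻¹ * Real.log (∑ j, ℓ j * ‖inner 𝕜 (v (j + k)) g‖ ^ 2)
        ∂stdGaussian E := by
    rw [integral_finsetSum _ hi]
    simp_rw [integral_const_mul, hinv (hshift _), hinv hv]
    rw [Finset.sum_const, Finset.card_univ, Fintype.card_fin, nsmul_eq_mul, ← mul_assoc,
      mul_inv_cancel₀ hr.ne', one_mul]
  have hsum := log_sum_norm_inner_sq hE hv
  rw [Fintype.card_fin] at hsum
  have hle : ∫ g, ∑ k, (r : ℝ)⁻¹ * Real.log (∑ j, ℓ j * ‖inner 𝕜 (v (j + k)) g‖ ^ 2)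
        ∂stdGaussian E ≤
      ∫ g, (Real.log (∑ j, ‖inner 𝕜 (v j) g‖ ^ 2) + (Real.log (∑ i, ℓ i) - Real.log r))
        ∂stdGaussian E := by
    refine integral_mono_ae (integrable_finsetSum _ hi) (hsum.1.add (integrable_const _)) ?_
    filter_upwards [ae_norm_inner_sq_pos hE hv] with g hg
    have hW : 0 < ∑ j, ‖inner 𝕜 (v j) g‖ ^ 2 :=
      Finset.sum_pos (fun i _ => hg i) Finset.univ_nonempty
    have h := strictConcaveOn_log_Ioi.concaveOn.le_map_sum (t := Finset.univ)
      (w := fun _ : Fin r => (r : ℝ)⁻¹)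
      (p := fun k => ∑ j, ℓ j * ‖inner 𝕜 (v (j + k)) g‖ ^ 2) (fun _ _ => by positivity)
      (by simp [hr.ne'])
      fun k _ => Finset.sum_pos (fun j _ => mul_pos (hℓ j) (hg _)) Finset.univ_nonempty
    have h2 : ∑ k, (r : ℝ)⁻¹ • ∑ j, ℓ j * ‖inner 𝕜 (v (j + k)) g‖ ^ 2 =
        (∑ j, ‖inner 𝕜 (v j) g‖ ^ 2) * ((∑ i, ℓ i) / r) := by
      have h3 : ∀ j, ∑ k, ‖inner 𝕜 (v (j + k)) g‖ ^ 2 = ∑ k, ‖inner 𝕜 (v k) g‖ ^ 2 := fun j =>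
        Equiv.sum_comp (Equiv.addLeft j) fun k => ‖inner 𝕜 (v k) g‖ ^ 2
      rw [← Finset.smul_sum, Finset.sum_comm]
      simp_rw [← Finset.mul_sum, h3, ← Finset.sum_mul, smul_eq_mul]
      ring
    rw [h2, Real.log_mul hW.ne' (by positivity), Real.log_div hT.ne' hr.ne'] at h
    simpa only [smul_eq_mul] using h
  rw [havg]
  refine hle.trans (le_of_eq ?_)
  rw [integral_add hsum.1 (integrable_const _), hsum.2]
  simp
  ring

end ExpectedLog

/-! ### Positive semidefinite quadratic forms -/

section QuadForm

variable {𝕜 : Type*} [RCLike 𝕜] {n d : ℕ}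

lemma inner_toEuclideanCLM_of_isHermitian {S : Matrix (Fin n) (Fin n) 𝕜} (hS : S.IsHermitian)
    (x y : EuclideanSpace 𝕜 (Fin n)) :
    inner 𝕜 (Matrix.toEuclideanCLM (𝕜 := 𝕜) S x) y =
      inner 𝕜 x (Matrix.toEuclideanCLM (𝕜 := 𝕜) S y) := by
  have h : IsSelfAdjoint (Matrix.toEuclideanCLM (n := Fin n) (𝕜 := 𝕜) S) :=
    IsSelfAdjoint.map (show IsSelfAdjoint S from hS) _
  rw [← ContinuousLinearMap.adjoint_inner_left, h.adjoint_eq]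

lemma quadForm_nonneg {A : Matrix (Fin n) (Fin n) 𝕜} (hA : A.PosSemidef)
    (x : EuclideanSpace 𝕜 (Fin n)) : 0 ≤ quadForm A x := by
  have h := hA.re_dotProduct_nonneg x.ofLp
  rwa [quadForm, EuclideanSpace.inner_eq_star_dotProduct, Matrix.ofLp_toEuclideanCLM,
    dotProduct_comm]

lemma quadForm_smul (A : Matrix (Fin n) (Fin n) 𝕜) (c : ℝ) (x : EuclideanSpace 𝕜 (Fin n)) :
    quadForm A ((c : 𝕜) • x) = c ^ 2 * quadForm A x := by
  rw [quadForm, map_smul, inner_smul_left, inner_smul_right, RCLike.conj_ofReal,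
    RCLike.re_ofReal_mul, RCLike.re_ofReal_mul, quadForm]
  ring

lemma continuous_quadForm (A : Matrix (Fin n) (Fin n) 𝕜) : Continuous (quadForm A) := by
  unfold quadForm
  fun_prop

lemma quadForm_toEuclideanCLM {S : Matrix (Fin n) (Fin n) 𝕜} (hS : S.IsHermitian)
    (A : Matrix (Fin n) (Fin n) 𝕜) (x : EuclideanSpace 𝕜 (Fin n)) :
    quadForm A (Matrix.toEuclideanCLM (𝕜 := 𝕜) S x) = quadForm (S * A * S) x := by
  rw [quadForm, inner_toEuclideanCLM_of_isHermitian hS, quadForm, map_mul, map_mul]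
  rfl

lemma quadForm_eq_sum_eigenvalues {B : Matrix (Fin n) (Fin n) 𝕜} (hB : B.IsHermitian)
    (x : EuclideanSpace 𝕜 (Fin n)) :
    quadForm B x = ∑ i, hB.eigenvalues i * ‖inner 𝕜 (hB.eigenvectorBasis i) x‖ ^ 2 := by
  have hb : ∀ i, Matrix.toEuclideanCLM (𝕜 := 𝕜) B (hB.eigenvectorBasis i) =
      (hB.eigenvalues i : 𝕜) • hB.eigenvectorBasis i := fun i => by
    ext j
    have h := congrFun (hB.mulVec_eigenvectorBasis i) j
    rw [Matrix.ofLp_toEuclideanCLM, h]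
    simp [RCLike.real_smul_eq_coe_mul]
  rw [quadForm, ← hB.eigenvectorBasis.sum_inner_mul_inner, map_sum]
  refine Finset.sum_congr rfl fun i _ => ?_
  rw [← inner_toEuclideanCLM_of_isHermitian hB, hb, inner_smul_left, RCLike.conj_ofReal,
    mul_left_comm, RCLike.re_ofReal_mul, ← inner_conj_symm x, RCLike.conj_mul]
  norm_cast

/-- A positive semidefinite form of rank `r` is a positive combination of `r` squared moduli of
orthonormal coordinates. -/
lemma exists_orthonormal_quadForm_eq {B : Matrix (Fin n) (Fin n) 𝕜} (hB : B.PosSemidef) :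
    ∃ (v : Fin B.rank → EuclideanSpace 𝕜 (Fin n)) (ℓ : Fin B.rank → ℝ),
      Orthonormal 𝕜 v ∧ (∀ j, 0 < ℓ j) ∧ ∑ j, ℓ j = RCLike.re B.trace ∧
        ∀ x, quadForm B x = ∑ j, ℓ j * ‖inner 𝕜 (v j) x‖ ^ 2 := by
  classical
  have hH := hB.isHermitian
  let e : Fin B.rank ≃ {i // hH.eigenvalues i ≠ 0} :=
    (Fintype.equivFinOfCardEq hH.rank_eq_card_non_zero_eigs.symm).symm
  have hsum : ∀ f : Fin n → ℝ, (∀ i, hH.eigenvalues i = 0 → f i = 0) →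
      ∑ j, f (e j) = ∑ i, f i := fun f hf => by
    rw [e.sum_comp fun i => f i, ← Finset.sum_subtype (Finset.univ.filter fun i =>
      hH.eigenvalues i ≠ 0) (by simp) f]
    exact Finset.sum_filter_of_ne fun i _ hi h => hi (hf i h)
  refine ⟨fun j => hH.eigenvectorBasis (e j), fun j => hH.eigenvalues (e j),
    hH.eigenvectorBasis.orthonormal.comp _ (Subtype.val_injective.comp e.injective),
    fun j => (hB.eigenvalues_nonneg _).lt_of_ne (e j).2.symm, ?_, fun x => ?_⟩
  · rw [hsum _ fun _ h => h, hH.trace_eq_sum_eigenvalues]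
    simp
  · rw [quadForm_eq_sum_eigenvalues hH, ← hsum]
    intro i hi
    rw [hi, zero_mul]

lemma rank_pos_of_re_trace_pos {B : Matrix (Fin n) (Fin n) 𝕜} (hB : B.PosSemidef)
    (h : 0 < RCLike.re B.trace) : 0 < B.rank := by
  obtain ⟨v, ℓ, -, -, hsum, -⟩ := exists_orthonormal_quadForm_eq hB
  refine Nat.pos_of_ne_zero fun h0 => h.ne ?_
  have : IsEmpty (Fin B.rank) := by rw [h0]; infer_instance
  rw [← hsum, Finset.univ_eq_empty, Finset.sum_empty]

lemma norm_sq_sqrt_apply {X : Matrix (Fin n) (Fin n) 𝕜} (hX : X.PosSemidef)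
    (x : EuclideanSpace 𝕜 (Fin n)) :
    ‖Matrix.toEuclideanCLM (𝕜 := 𝕜) (CFC.sqrt X) x‖ ^ 2 = quadForm X x := by
  have hS : (CFC.sqrt X).IsHermitian := (CFC.sqrt_nonneg X).isSelfAdjoint
  rw [← inner_self_eq_norm_sq (𝕜 := 𝕜), inner_toEuclideanCLM_of_isHermitian hS, quadForm]
  conv_rhs => rw [← CFC.sqrt_mul_sqrt_self X hX.nonneg, map_mul]
  rfl

lemma posSemidef_sqrt_mul_mul_sqrt {A : Matrix (Fin n) (Fin n) 𝕜} (hA : A.PosSemidef)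
    (X : Matrix (Fin n) (Fin n) 𝕜) : (CFC.sqrt X * A * CFC.sqrt X).PosSemidef := by
  have hS : (CFC.sqrt X).IsHermitian := (CFC.sqrt_nonneg X).isSelfAdjoint
  simpa [hS.eq] using hA.conjTranspose_mul_mul_same (CFC.sqrt X)

lemma re_trace_sqrt_mul_mul_sqrt {A X : Matrix (Fin n) (Fin n) 𝕜} (hA : A.PosSemidef)
    (hX : X.PosSemidef) :
    RCLike.re (CFC.sqrt X * A * CFC.sqrt X).trace = traceInner A X := by
  rw [Matrix.trace_mul_comm, ← mul_assoc, CFC.sqrt_mul_sqrt_self X hX.nonneg,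
    Matrix.trace_mul_comm, traceInner, hA.isHermitian.eq]

lemma traceInner_nonneg {A X : Matrix (Fin n) (Fin n) 𝕜} (hA : A.PosSemidef)
    (hX : X.PosSemidef) : 0 ≤ traceInner A X := by
  rw [← re_trace_sqrt_mul_mul_sqrt hA hX]
  exact (RCLike.nonneg_iff.1 (posSemidef_sqrt_mul_mul_sqrt hA X).trace_nonneg).1

/-! ### The two optimization problems -/

lemma continuous_objective (A : Fin d → Matrix (Fin n) (Fin n) 𝕜) : Continuous (objective A) :=
  (continuous_finsetProd _ fun i _ => continuous_quadForm (A i)).rpow_const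
    fun _ => Or.inr (by positivity)

lemma objective_nonneg {A : Fin d → Matrix (Fin n) (Fin n) 𝕜} (hA : ∀ i, (A i).PosSemidef)
    (x : EuclideanSpace 𝕜 (Fin n)) : 0 ≤ objective A x :=
  Real.rpow_nonneg (Finset.prod_nonneg fun i _ => quadForm_nonneg (hA i) x) _

lemma IsFeasible.rank_pos {X : Matrix (Fin n) (Fin n) 𝕜} (hX : IsFeasible X) : 0 < X.rank :=
  rank_pos_of_re_trace_pos hX.1 (by simp [hX.2])

lemma IsFeasible.dim_pos {X : Matrix (Fin n) (Fin n) 𝕜} (hX : IsFeasible X) : 0 < n :=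
  hX.rank_pos.trans_le (by simpa using X.rank_le_width)

lemma isGreatest_Opt (hn : 0 < n) (A : Fin d → Matrix (Fin n) (Fin n) 𝕜) :
    IsGreatest (sphereValues A) (Opt A) := by
  have : ProperSpace (EuclideanSpace 𝕜 (Fin n)) := FiniteDimensional.proper_rclike 𝕜 _
  have himage : sphereValues A = objective A '' Metric.sphere 0 1 := by
    ext v
    simp [sphereValues]
  rw [Opt, himage]
  refine ((isCompact_sphere _ _).image (continuous_objective A)).isGreatest_sSup
    (Set.Nonempty.image _ ⟨EuclideanSpace.single ⟨0, hn⟩ 1, ?_⟩)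
  simp

lemma isGreatest_OptSDP {A : Fin d → Matrix (Fin n) (Fin n) 𝕜} {X : Matrix (Fin n) (Fin n) 𝕜}
    (hX : IsOptimalSDP A X) :
    IsGreatest (sdpValues A) (OptSDP A) ∧ OptSDP A = sdpObjective A X := by
  have h : IsGreatest (sdpValues A) (sdpObjective A X) :=
    ⟨⟨X, hX.1, rfl⟩, by rintro _ ⟨Y, hY, rfl⟩; exact hX.2 Y hY⟩
  have h2 : OptSDP A = sdpObjective A X := h.csSup_eq
  exact ⟨h2 ▸ h, h2⟩

/-- The relaxation bounds the original problem: a unit vector `x` yields the feasible rank one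
matrix `x x†` with the same objective. -/
lemma Opt_le_OptSDP (hn : 0 < n) {A : Fin d → Matrix (Fin n) (Fin n) 𝕜}
    (hA : ∀ i, (A i).PosSemidef) {X : Matrix (Fin n) (Fin n) 𝕜} (hX : IsOptimalSDP A X) :
    Opt A ≤ OptSDP A := by
  obtain ⟨x, hx, hxv⟩ := (isGreatest_Opt hn A).1
  refine (isGreatest_OptSDP hX).1.2
    ⟨Matrix.vecMulVec x.ofLp (star x.ofLp), ⟨Matrix.posSemidef_vecMulVec_self_star _, ?_⟩, ?_⟩
  · rw [Matrix.trace_vecMulVec, ← EuclideanSpace.inner_eq_star_dotProduct,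
      inner_self_eq_norm_sq_to_K, hx]
    simp
  · rw [← hxv, sdpObjective, objective]
    congr 1
    refine Finset.prod_congr rfl fun i _ => ?_
    rw [traceInner, (hA i).isHermitian.eq, Matrix.mul_vecMulVec, Matrix.trace_vecMulVec, quadForm,
      EuclideanSpace.inner_eq_star_dotProduct, Matrix.ofLp_toEuclideanCLM]

end QuadForm

/-! ### The rounding procedure -/

section Rounding

variable {𝕜 : Type*} [RCLike 𝕜] {n d : ℕ}

variable (𝕜) in
/-- The exponent `L_r(𝕜)`, written uniformly in the real dimension `m` of `𝕜`:
`ψ(m r / 2) - log r - ψ(m / 2)`. -/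
noncomputable def approxExponent (r : ℕ) : ℝ :=
  digamma (((Module.finrank ℝ 𝕜 * r : ℕ) : ℝ) / 2) - Real.log r -
    digamma ((Module.finrank ℝ 𝕜 : ℝ) / 2)

lemma approxExponent_real (r : ℕ) (hr : 0 < r) : approxExponent ℝ r = LReal r := by
  have hr' : (r : ℝ) ≠ 0 := by positivity
  have h := digamma_one_half
  rw [approxExponent, LReal, Module.finrank_self, one_mul, Nat.cast_one, h,
    Real.log_div hr' two_ne_zero]
  ring

lemma approxExponent_complex (r : ℕ) : approxExponent ℂ r = LComplex r := by
  have h := digamma_one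
  rw [approxExponent, LComplex, Complex.finrank_real_complex, Nat.cast_mul, Nat.cast_ofNat,
    mul_div_cancel_left₀ _ two_ne_zero, div_self two_ne_zero, h]
  ring

/-- The rounding map: a standard Gaussian vector `g` is sent to the normalization of `X^{1/2} g`. -/
noncomputable def roundVec (X : Matrix (Fin n) (Fin n) 𝕜) (g : EuclideanSpace 𝕜 (Fin n)) :
    EuclideanSpace 𝕜 (Fin n) :=
  ((‖Matrix.toEuclideanCLM (𝕜 := 𝕜) (CFC.sqrt X) g‖⁻¹ : ℝ) : 𝕜) •
    Matrix.toEuclideanCLM (𝕜 := 𝕜) (CFC.sqrt X) g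

lemma measurable_normalize :
    Measurable fun x : EuclideanSpace 𝕜 (Fin n) => ((‖x‖⁻¹ : ℝ) : 𝕜) • x := by
  fun_prop

lemma measurable_roundVec (X : Matrix (Fin n) (Fin n) 𝕜) : Measurable (roundVec X) := by
  unfold roundVec
  fun_prop

lemma norm_roundVec {X : Matrix (Fin n) (Fin n) 𝕜} (hX : X.PosSemidef)
    {g : EuclideanSpace 𝕜 (Fin n)} (hg : 0 < quadForm X g) : ‖roundVec X g‖ = 1 := by
  rw [← norm_sq_sqrt_apply hX] at hg
  have : ‖Matrix.toEuclideanCLM (𝕜 := 𝕜) (CFC.sqrt X) g‖ ≠ 0 := by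
    intro h
    simp [h] at hg
  rw [roundVec, norm_smul, RCLike.norm_ofReal, abs_inv, abs_norm, inv_mul_cancel₀ this]

lemma quadForm_roundVec {A X : Matrix (Fin n) (Fin n) 𝕜} (hX : X.PosSemidef)
    (g : EuclideanSpace 𝕜 (Fin n)) :
    quadForm A (roundVec X g) =
      quadForm (CFC.sqrt X * A * CFC.sqrt X) g / quadForm X g := by
  have hS : (CFC.sqrt X).IsHermitian := (CFC.sqrt_nonneg X).isSelfAdjoint
  rw [roundVec, quadForm_smul, quadForm_toEuclideanCLM hS, inv_pow, norm_sq_sqrt_apply hX,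
    inv_mul_eq_div]

/-- Where all forms are positive, the rounded objective is the exponential of the average of the
`log ⟨x, A i x⟩`, minus `log ‖x‖²`. -/
lemma objective_roundVec (hd : 0 < d) {A : Fin d → Matrix (Fin n) (Fin n) 𝕜}
    {X : Matrix (Fin n) (Fin n) 𝕜} (hX : X.PosSemidef) {g : EuclideanSpace 𝕜 (Fin n)}
    (hg : 0 < quadForm X g)
    (hA : ∀ i, 0 < quadForm (CFC.sqrt X * A i * CFC.sqrt X) g) :
    objective A (roundVec X g) =
      Real.exp (1 / (d : ℝ) * ∑ i, Real.log (quadForm (CFC.sqrt X * A i * CFC.sqrt X) g) -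
        Real.log (quadForm X g)) := by
  have hd' : (d : ℝ) ≠ 0 := by positivity
  rw [objective]
  simp_rw [quadForm_roundVec hX]
  rw [Real.rpow_def_of_pos (Finset.prod_pos fun i _ => div_pos (hA i) hg),
    Real.log_prod fun i _ => (div_pos (hA i) hg).ne']
  simp_rw [Real.log_div (hA _).ne' hg.ne']
  rw [Finset.sum_sub_distrib, Finset.sum_const, Finset.card_univ, Fintype.card_fin, nsmul_eq_mul]
  congr 1
  field_simp

lemma real_inner_euclideanSpace (x y : EuclideanSpace 𝕜 (Fin n)) :
    inner ℝ x y = RCLike.re (inner 𝕜 x y) := by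
  simp [PiLp.inner_apply, real_inner_eq_re_inner 𝕜]

lemma ae_quadForm_pos
    {B : Matrix (Fin n) (Fin n) 𝕜} (hB : B.PosSemidef) (htr : 0 < RCLike.re B.trace) :
    ∀ᵐ g ∂stdGaussian (EuclideanSpace 𝕜 (Fin n)), 0 < quadForm B g := by
  have : NeZero B.rank := ⟨(rank_pos_of_re_trace_pos hB htr).ne'⟩
  obtain ⟨v, ℓ, hv, hℓ, -, hB'⟩ := exists_orthonormal_quadForm_eq hB
  filter_upwards [ae_norm_inner_sq_pos real_inner_euclideanSpace hv] with g hg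
  rw [hB']
  exact Finset.sum_pos (fun j _ => mul_pos (hℓ j) (hg j)) Finset.univ_nonempty

lemma integrable_log_quadForm
    {B : Matrix (Fin n) (Fin n) 𝕜} (hB : B.PosSemidef) (htr : 0 < RCLike.re B.trace) :
    Integrable (fun g => Real.log (quadForm B g)) (stdGaussian (EuclideanSpace 𝕜 (Fin n))) := by
  have : NeZero B.rank := ⟨(rank_pos_of_re_trace_pos hB htr).ne'⟩
  obtain ⟨v, ℓ, hv, hℓ, -, hB'⟩ := exists_orthonormal_quadForm_eq hB
  simp_rw [hB']
  exact integrable_log_sum_mul real_inner_euclideanSpace hv hℓ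

lemma le_integral_log_quadForm
    {B : Matrix (Fin n) (Fin n) 𝕜} (hB : B.PosSemidef) (htr : 0 < RCLike.re B.trace) :
    digamma ((Module.finrank ℝ 𝕜 : ℝ) / 2) + Real.log 2 + Real.log (RCLike.re B.trace) ≤
      ∫ g, Real.log (quadForm B g) ∂stdGaussian (EuclideanSpace 𝕜 (Fin n)) := by
  have : NeZero B.rank := ⟨(rank_pos_of_re_trace_pos hB htr).ne'⟩
  obtain ⟨v, ℓ, hv, hℓ, hsum, hB'⟩ := exists_orthonormal_quadForm_eq hB
  simp_rw [hB', ← hsum]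
  exact le_integral_log_sum_mul real_inner_euclideanSpace hv hℓ

lemma integral_log_quadForm_le
    {B : Matrix (Fin n) (Fin n) 𝕜} (hB : B.PosSemidef) (htr : 0 < RCLike.re B.trace) :
    ∫ g, Real.log (quadForm B g) ∂stdGaussian (EuclideanSpace 𝕜 (Fin n)) ≤
      digamma (((Module.finrank ℝ 𝕜 * B.rank : ℕ) : ℝ) / 2) + Real.log 2 +
        Real.log (RCLike.re B.trace) - Real.log B.rank := by
  have : NeZero B.rank := ⟨(rank_pos_of_re_trace_pos hB htr).ne'⟩
  obtain ⟨v, ℓ, hv, hℓ, hsum, hB'⟩ := exists_orthonormal_quadForm_eq hB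
  simp_rw [hB', ← hsum]
  exact integral_log_sum_mul_le real_inner_euclideanSpace hv hℓ

lemma ae_norm_roundVec
    {X : Matrix (Fin n) (Fin n) 𝕜} (hX : IsFeasible X) :
    ∀ᵐ g ∂stdGaussian (EuclideanSpace 𝕜 (Fin n)), ‖roundVec X g‖ = 1 := by
  filter_upwards [ae_quadForm_pos hX.1 (by simp [hX.2])] with g hg using norm_roundVec hX.1 hg

lemma integrable_objective_roundVec
    {A : Fin d → Matrix (Fin n) (Fin n) 𝕜} (hA : ∀ i, (A i).PosSemidef)
    {X : Matrix (Fin n) (Fin n) 𝕜} (hX : IsFeasible X) :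
    Integrable (fun g => objective A (roundVec X g))
      (stdGaussian (EuclideanSpace 𝕜 (Fin n))) := by
  refine Integrable.of_bound ((continuous_objective A).measurable.comp
    (measurable_roundVec X)).aestronglyMeasurable (Opt A) ?_
  filter_upwards [ae_norm_roundVec hX] with g hg
  rw [Real.norm_of_nonneg (objective_nonneg hA _)]
  exact (isGreatest_Opt hX.dim_pos A).2 ⟨_, hg, rfl⟩

/-- The expected value of the rounded objective: Jensen's inequality for the exponential, combined
with the two bounds on expected logarithms. -/
lemma le_integral_objective_roundVec (hd : 0 < d)
    {A : Fin d → Matrix (Fin n) (Fin n) 𝕜} (hA : ∀ i, (A i).PosSemidef)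
    {X : Matrix (Fin n) (Fin n) 𝕜} (hX : IsFeasible X) :
    Real.exp (-approxExponent 𝕜 X.rank) * sdpObjective A X ≤
      ∫ g, objective A (roundVec X g) ∂stdGaussian (EuclideanSpace 𝕜 (Fin n)) := by
  have hd' : (d : ℝ) ≠ 0 := by positivity
  -- If some `⟨A i, X⟩` vanishes, so does the left-hand side; otherwise all logarithms are genuine.
  by_cases hzero : ∃ i, traceInner (A i) X = 0
  · obtain ⟨i, hi⟩ := hzero
    rw [sdpObjective, Finset.prod_eq_zero (Finset.mem_univ i) hi,
      Real.zero_rpow (by positivity), mul_zero]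
    exact integral_nonneg fun g => objective_nonneg hA _
  have htr : ∀ i, 0 < traceInner (A i) X := fun i =>
    (traceInner_nonneg (hA i) hX.1).lt_of_ne fun h => hzero ⟨i, h.symm⟩
  have hB : ∀ i, (CFC.sqrt X * A i * CFC.sqrt X).PosSemidef :=
    fun i => posSemidef_sqrt_mul_mul_sqrt (hA i) X
  have hBtr : ∀ i, RCLike.re (CFC.sqrt X * A i * CFC.sqrt X).trace = traceInner (A i) X :=
    fun i => re_trace_sqrt_mul_mul_sqrt (hA i) hX.1
  have hXtr : RCLike.re X.trace = 1 := by simp [hX.2]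
  have hBpos : ∀ i, 0 < RCLike.re (CFC.sqrt X * A i * CFC.sqrt X).trace := fun i => by
    rw [hBtr]
    exact htr i
  have hXpos : 0 < RCLike.re X.trace := by simp [hXtr]
  set μ := stdGaussian (EuclideanSpace 𝕜 (Fin n))
  set Y : EuclideanSpace 𝕜 (Fin n) → ℝ := fun g =>
    1 / (d : ℝ) * ∑ i, Real.log (quadForm (CFC.sqrt X * A i * CFC.sqrt X) g) -
      Real.log (quadForm X g) with hY
  have hi : ∀ i ∈ Finset.univ, Integrable (fun g =>
      Real.log (quadForm (CFC.sqrt X * A i * CFC.sqrt X) g)) μ :=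
    fun i _ => integrable_log_quadForm (hB i) (hBpos i)
  have hiX : Integrable (fun g => Real.log (quadForm X g)) μ :=
    integrable_log_quadForm hX.1 hXpos
  have hYint : Integrable Y μ := ((integrable_finsetSum _ hi).const_mul _).sub hiX
  have hexp : (fun g => objective A (roundVec X g)) =ᵐ[μ] fun g => Real.exp (Y g) := by
    filter_upwards [ae_quadForm_pos hX.1 hXpos,
      ae_all_iff.2 fun i => ae_quadForm_pos (hB i) (hBpos i)] with g h1 h2
    exact objective_roundVec hd hX.1 h1 h2
  have hjensen : Real.exp (∫ g, Y g ∂μ) ≤ ∫ g, Real.exp (Y g) ∂μ :=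
    convexOn_exp.map_integral_le Real.continuous_exp.continuousOn isClosed_univ (by simp) hYint
      ((integrable_objective_roundVec hA hX).congr hexp)
  have hYval : ∑ i, Real.log (traceInner (A i) X) * (1 / (d : ℝ)) - approxExponent 𝕜 X.rank ≤
      ∫ g, Y g ∂μ := by
    rw [hY, integral_sub ((integrable_finsetSum _ hi).const_mul _) hiX, integral_const_mul,
      integral_finsetSum _ hi]
    have hsum := Finset.sum_le_sum fun i (_ : i ∈ Finset.univ) =>
      le_integral_log_quadForm (hB i) (hBpos i)
    simp_rw [hBtr] at hsum
    rw [Finset.sum_add_distrib, Finset.sum_const, Finset.card_univ, Fintype.card_fin,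
      nsmul_eq_mul] at hsum
    have hmul := mul_le_mul_of_nonneg_left hsum (show 0 ≤ 1 / (d : ℝ) by positivity)
    rw [mul_add, ← mul_assoc, one_div_mul_cancel hd', one_mul] at hmul
    have hup := integral_log_quadForm_le hX.1 hXpos
    rw [hXtr, Real.log_one] at hup
    rw [← Finset.sum_mul, mul_comm, approxExponent]
    linarith
  rw [integral_congr_ae hexp]
  refine le_trans (le_of_eq ?_) ((Real.exp_le_exp.2 hYval).trans hjensen)
  rw [sdpObjective, Real.rpow_def_of_pos (Finset.prod_pos fun i _ => htr i),
    Real.log_prod fun i _ => (htr i).ne', ← Real.exp_add, Finset.sum_mul, neg_add_eq_sub]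

/-- The guarantees of the rounding procedure; the bound on `Opt A` follows because it dominates the
objective at almost every rounded vector. -/
lemma approximation_of_law_eq (hd : 0 < d)
    {A : Fin d → Matrix (Fin n) (Fin n) 𝕜} (hA : ∀ i, (A i).PosSemidef)
    {X : Matrix (Fin n) (Fin n) 𝕜} (hX : IsOptimalSDP A X)
    {ν : Measure (EuclideanSpace 𝕜 (Fin n))}
    (hν : ν = (stdGaussian (EuclideanSpace 𝕜 (Fin n))).map (roundVec X)) :
    Real.exp (-approxExponent 𝕜 X.rank) * OptSDP A ≤ Opt A ∧
      (∀ᵐ y ∂ν, ‖y‖ = 1) ∧ Integrable (objective A) ν ∧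
      Real.exp (-approxExponent 𝕜 X.rank) * OptSDP A ≤ ∫ y, objective A y ∂ν := by
  have hmeas := (continuous_objective A).measurable
  have hround := measurable_roundVec X
  have hint := integrable_objective_roundVec hA hX.1
  have hval := le_integral_objective_roundVec hd hA hX.1
  rw [← (isGreatest_OptSDP hX).2] at hval
  refine ⟨hval.trans ?_, ?_, ?_, ?_⟩
  · refine (integral_mono_ae hint (integrable_const (Opt A)) ?_).trans (by simp)
    filter_upwards [ae_norm_roundVec hX.1] with g hg
    exact (isGreatest_Opt hX.1.dim_pos A).2 ⟨_, hg, rfl⟩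
  · rw [hν, ae_map_iff hround.aemeasurable (measurableSet_eq_fun measurable_norm measurable_const)]
    exact ae_norm_roundVec hX.1
  · rw [hν, integrable_map_measure hmeas.aestronglyMeasurable hround.aemeasurable]
    exact hint
  · rwa [hν, integral_map hround.aemeasurable hmeas.aestronglyMeasurable]

end Rounding

/-! ### The Gaussian laws -/

lemma normalizedLaw_multivariateGaussian {n : ℕ} (X : Matrix (Fin n) (Fin n) ℝ) :
    normalizedLaw (𝕜 := ℝ) (multivariateGaussian 0 X) =
      (stdGaussian (EuclideanSpace ℝ (Fin n))).map (roundVec X) := by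
  rw [normalizedLaw, multivariateGaussian, Measure.map_map measurable_normalize (by fun_prop)]
  congr 1
  ext1 g
  simp [roundVec]

lemma charFun_stdComplexNormal (t : ℂ) :
    charFun stdComplexNormal t = Complex.exp (-‖t‖ ^ 2 / 4) := by
  have hin : ∀ p : ℝ × ℝ, Complex.exp ((inner ℝ (((p.1 : ℂ) + Complex.I * (p.2 : ℂ)) /
      (Real.sqrt 2 : ℂ)) t : ℝ) * Complex.I) =
      Complex.exp ((t.re / √2 : ℝ) * p.1 * Complex.I) *
        Complex.exp ((t.im / √2 : ℝ) * p.2 * Complex.I) := fun p => by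
    have h : inner ℝ (((p.1 : ℂ) + Complex.I * (p.2 : ℂ)) / (Real.sqrt 2 : ℂ)) t =
        t.re / √2 * p.1 + t.im / √2 * p.2 := by
      rw [Complex.inner]
      simp [Complex.div_ofReal_re, Complex.div_ofReal_im]
      ring
    rw [h, ← Complex.exp_add]
    push_cast
    ring_nf
  have hsq : ‖t‖ ^ 2 = t.re ^ 2 + t.im ^ 2 := by
    rw [← Complex.normSq_eq_norm_sq, Complex.normSq_apply]
    ring
  have h2 : (√2) ^ 2 = 2 := Real.sq_sqrt zero_le_two
  rw [charFun_apply, stdComplexNormal, integral_map (Measurable.aemeasurable (by fun_prop))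
    (Measurable.aestronglyMeasurable (by fun_prop))]
  simp_rw [hin]
  rw [integral_prod_mul (fun x : ℝ => Complex.exp ((t.re / √2 : ℝ) * x * Complex.I))
    (fun x : ℝ => Complex.exp ((t.im / √2 : ℝ) * x * Complex.I)), ← charFun_apply_real,
    ← charFun_apply_real, charFun_gaussianReal, charFun_gaussianReal, ← Complex.exp_add,
    ← Complex.ofReal_pow ‖t‖, hsq, ← Complex.ofReal_pow, ← Complex.ofReal_pow, div_pow, div_pow, h2]
  congr 1
  push_cast
  simp
  ring

/-- Up to the factor `1 / √2`, the law `N_ℂ(0, I)` is the standard Gaussian law of the real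
Euclidean space underlying `ℂⁿ`. -/
lemma stdComplexGaussian_eq (n : ℕ) :
    stdComplexGaussian n =
      (stdGaussian (EuclideanSpace ℂ (Fin n))).map (fun g => (√2)⁻¹ • g) := by
  have : IsProbabilityMeasure stdComplexNormal :=
    Measure.isProbabilityMeasure_map (Measurable.aemeasurable (by fun_prop))
  have : IsProbabilityMeasure (stdComplexGaussian n) :=
    Measure.isProbabilityMeasure_map (Measurable.aemeasurable (by fun_prop))
  have : IsProbabilityMeasure
      ((stdGaussian (EuclideanSpace ℂ (Fin n))).map fun g => (√2)⁻¹ • g) :=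
    Measure.isProbabilityMeasure_map (Measurable.aemeasurable (by fun_prop))
  refine Measure.ext_of_charFun (funext fun t => ?_)
  have h2 : ((√2)⁻¹) ^ 2 = (1 : ℝ) / 2 := by
    rw [inv_pow, Real.sq_sqrt zero_le_two, one_div]
  rw [stdComplexGaussian, charFun_pi, charFun_map_smul, charFun_stdGaussian]
  simp_rw [charFun_stdComplexNormal]
  rw [← Complex.exp_sum, ← Complex.ofReal_pow, norm_smul, mul_pow, Real.norm_eq_abs, sq_abs, h2,
    EuclideanSpace.norm_sq_eq]
  congr 1
  push_cast
  rw [Finset.mul_sum, ← Finset.sum_neg_distrib, Finset.sum_div]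
  exact Finset.sum_congr rfl fun i _ => by ring

lemma normalizedLaw_complexGaussian {n : ℕ} (X : Matrix (Fin n) (Fin n) ℂ) :
    normalizedLaw (𝕜 := ℂ) (complexGaussian X) =
      (stdGaussian (EuclideanSpace ℂ (Fin n))).map (roundVec X) := by
  rw [normalizedLaw, complexGaussian, stdComplexGaussian_eq,
    Measure.map_map (by fun_prop) (by fun_prop), Measure.map_map (by fun_prop) (by fun_prop)]
  congr 1
  ext1 g
  have h2 : (√2)⁻¹ ≠ (0 : ℝ) := by positivity
  have hs : (√2)⁻¹ • g = (((√2)⁻¹ : ℝ) : ℂ) • g := rfl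
  simp only [Function.comp_apply, roundVec]
  rw [hs, map_smul, norm_smul, smul_smul]
  congr 1
  rw [Complex.norm_real, Real.norm_of_nonneg (by positivity), mul_inv, ← Complex.coe_algebraMap]
  simp
  field_simp

end ProductPSD

theorem theorem1 (n d : ℕ) (hd : 1 ≤ d) :
    -- the real case
    (∀ (A : Fin d → Matrix (Fin n) (Fin n) ℝ) (X : Matrix (Fin n) (Fin n) ℝ) (r : ℕ),
      (∀ i, (A i).PosSemidef) → ProductPSD.IsOptimalSDP A X → X.rank = r →
        -- the two optima are attained maxima
        IsGreatest (ProductPSD.sphereValues A) (ProductPSD.Opt A) ∧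
        IsGreatest (ProductPSD.sdpValues A) (ProductPSD.OptSDP A) ∧
        -- the approximation guarantee
        ProductPSD.LReal r < 1.271 ∧
        Real.exp (-ProductPSD.LReal r) * ProductPSD.OptSDP A ≤ ProductPSD.Opt A ∧
        ProductPSD.Opt A ≤ ProductPSD.OptSDP A ∧
        -- the rounding procedure
        (∀ᵐ y ∂ProductPSD.normalizedLaw (𝕜 := ℝ) (multivariateGaussian 0 X), ‖y‖ = 1) ∧
        Integrable (ProductPSD.objective A)
          (ProductPSD.normalizedLaw (𝕜 := ℝ) (multivariateGaussian 0 X)) ∧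
        Real.exp (-ProductPSD.LReal r) * ProductPSD.OptSDP A ≤
          ∫ y, ProductPSD.objective A y
            ∂ProductPSD.normalizedLaw (𝕜 := ℝ) (multivariateGaussian 0 X)) ∧
    -- the complex case
    (∀ (A : Fin d → Matrix (Fin n) (Fin n) ℂ) (X : Matrix (Fin n) (Fin n) ℂ) (r : ℕ),
      (∀ i, (A i).PosSemidef) → ProductPSD.IsOptimalSDP A X → X.rank = r →
        IsGreatest (ProductPSD.sphereValues A) (ProductPSD.Opt A) ∧
        IsGreatest (ProductPSD.sdpValues A) (ProductPSD.OptSDP A) ∧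
        ProductPSD.LComplex r < 0.578 ∧
        Real.exp (-ProductPSD.LComplex r) * ProductPSD.OptSDP A ≤ ProductPSD.Opt A ∧
        ProductPSD.Opt A ≤ ProductPSD.OptSDP A ∧
        (∀ᵐ y ∂ProductPSD.normalizedLaw (𝕜 := ℂ) (ProductPSD.complexGaussian X), ‖y‖ = 1) ∧
        Integrable (ProductPSD.objective A)
          (ProductPSD.normalizedLaw (𝕜 := ℂ) (ProductPSD.complexGaussian X)) ∧
        Real.exp (-ProductPSD.LComplex r) * ProductPSD.OptSDP A ≤
          ∫ y, ProductPSD.objective A y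
            ∂ProductPSD.normalizedLaw (𝕜 := ℂ) (ProductPSD.complexGaussian X)) := by
  constructor
  · rintro A X r hA hX rfl
    have hr := hX.1.rank_pos
    have h := ProductPSD.approximation_of_law_eq hd hA hX
      (ProductPSD.normalizedLaw_multivariateGaussian X)
    rw [ProductPSD.approxExponent_real _ hr] at h
    exact ⟨ProductPSD.isGreatest_Opt hX.1.dim_pos A, (ProductPSD.isGreatest_OptSDP hX).1,
      ProductPSD.LReal_lt hr, h.1, ProductPSD.Opt_le_OptSDP hX.1.dim_pos hA hX, h.2⟩
  · rintro A X r hA hX rfl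
    have h := ProductPSD.approximation_of_law_eq hd hA hX
      (ProductPSD.normalizedLaw_complexGaussian X)
    rw [ProductPSD.approxExponent_complex] at h
    exact ⟨ProductPSD.isGreatest_Opt hX.1.dim_pos A, (ProductPSD.isGreatest_OptSDP hX).1,
      ProductPSD.LComplex_lt hX.1.rank_pos, h.1,
      ProductPSD.Opt_le_OptSDP hX.1.dim_pos hA hX, h.2⟩
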